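/- Let $G$ be a simple graph on $n$ vertices with $(0,1)$-adjacency matrix $A$, let $e$ be the all-one vector, and let $W=[e,Ae,A^2e,\dots,A^{n-1}e]$ be its walk-matrix and $W_1=[e,A^2e,A^4e,\dots,A^{2n-2}e]$. Let $\widehat W=W$ and $\widehat W_1=W_1$ if $n$ is even, and let $\widehat W$, $\widehat W_1$ be obtained from $W$, $W_1$ by deleting the first column if $n$ is odd; then $\tfrac12 W^{T}\widehat W_1$ is an integral matrix. Suppose that 1. $G$ is controllable, i.e. $\det W\neq 0$; 2. $\operatorname{rank}_2(W)=\lceil n/2\rceil$, where $\operatorname{rank}_2$ denotes the rank over the field $\mathbf F_2$; 3. the Smith normal form of $W$ is $\operatorname{diag}(1,\dots,1,2^{l_1},2^{l_2},\dots,2^{l_t}b)$ with $\lceil n/2\rceil$ leading ones, $t=\lfloor n/2\rfloor$, integers $l_i\ge 0$ and a square-free integer $b$ (the factor $b$ being absent if $t=0$); 4. $\{x : \tfrac12 W^{T}\widehat W_1\,x\equiv 0 \pmod 2\}\subseteq\{x : \widehat W x\equiv 0 \pmod 2\}$. Then $G$ is determined by its generalized spectrum: every graph $H$ such that $H$ has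 the same spectrum as $G$ and the complement of $H$ has the same spectrum as the complement of $G$ (eigenvalues of adjacency matrices counted with multiplicity) is isomorphic to $G$. -/

import Mathlib

namespace GenSpec

open Matrix

/-- The `(0,1)`-adjacency matrix of `G` with entries in `R`. -/
noncomputable def adj {V : Type} (R : Type) [Zero R] [One R] (G : SimpleGraph V) :
    Matrix V V R := by
  classical exact G.adjMatrix R

/-- The spectrum of `G`: the multiset of all (complex) eigenvalues of the adjacency matrix, with
their multiplicities. -/
noncomputable def spec {n : ℕ} (G : SimpleGraph (Fin n)) : Multiset ℂ :=
  (adj ℂ G).charpoly.roots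

/-- `G` and `H` have the same generalized spectrum: equal spectra, and equal spectra of the
complements. -/
def SameGenSpec {n m : ℕ} (G : SimpleGraph (Fin n)) (H : SimpleGraph (Fin m)) : Prop :=
  spec G = spec H ∧ spec Gᶜ = spec Hᶜ

/-- `G` is determined by its generalized spectrum (DGS): every finite graph with the same
generalized spectrum is isomorphic to `G`. -/
def IsDGS {n : ℕ} (G : SimpleGraph (Fin n)) : Prop :=
  ∀ (m : ℕ) (H : SimpleGraph (Fin m)), SameGenSpec G H → Nonempty (G ≃g H)

/-- The walk-matrix `W = [e, Ae, A²e, …, Aⁿ⁻¹e]`, where `e` is the all-one vector. -/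
noncomputable def walkMatrix {n : ℕ} (G : SimpleGraph (Fin n)) : Matrix (Fin n) (Fin n) ℤ :=
  Matrix.of fun i j => ((adj ℤ G ^ (j : ℕ)) *ᵥ 1) i

/-- The matrix `W₁ = [e, A²e, A⁴e, …, A²ⁿ⁻²e]`. -/
noncomputable def walkMatrixSq {n : ℕ} (G : SimpleGraph (Fin n)) : Matrix (Fin n) (Fin n) ℤ :=
  Matrix.of fun i j => ((adj ℤ G ^ (2 * (j : ℕ))) *ᵥ 1) i

/-- `G` is controllable: its walk-matrix is non-singular. -/
def Controllable {n : ℕ} (G : SimpleGraph (Fin n)) : Prop :=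
  (walkMatrix G).det ≠ 0

/-- Reduction of an integer matrix modulo 2. -/
def mod2 {α β : Type} (M : Matrix α β ℤ) : Matrix α β (ZMod 2) :=
  M.map (fun z : ℤ => (z : ZMod 2))

/-- `rank₂(M)`, the rank of an integer matrix over the field with two elements. -/
noncomputable def rank2 {α β : Type} [Fintype β] (M : Matrix α β ℤ) : ℕ :=
  (mod2 M).rank

/-- `diag(d₁, …, dₙ)` is the Smith normal form of the integer matrix `M`: the `dᵢ` are nonnegative,
`dᵢ ∣ dᵢ₊₁`, and `M = U diag(d) V` with unimodular `U`, `V`. -/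
def IsSmithNormalForm {n : ℕ} (M : Matrix (Fin n) (Fin n) ℤ) (d : Fin n → ℤ) : Prop :=
  (∀ i, 0 ≤ d i) ∧ (∀ i j : Fin n, (j : ℕ) = (i : ℕ) + 1 → d i ∣ d j) ∧
    ∃ U V : Matrix (Fin n) (Fin n) ℤ, (U.det = 1 ∨ U.det = -1) ∧ (V.det = 1 ∨ V.det = -1) ∧
      M = U * Matrix.diagonal d * V

/-- The diagonal `(1, …, 1, 2^{l₁}, 2^{l₂}, …, 2^{l_t} b)` with `⌈n/2⌉ = (n + 1) / 2` leading ones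
and `t = ⌊n/2⌋`. The exponent standing at position `i` is called `l i`; its values at the
leading positions are not used. -/
def snfDiag {n : ℕ} (l : Fin n → ℕ) (b : ℤ) (i : Fin n) : ℤ :=
  if (i : ℕ) < (n + 1) / 2 then 1
  else if (i : ℕ) + 1 = n then 2 ^ l i * b
  else 2 ^ l i

/-- The indices of the columns which are kept: all of them if `n` is even, all but the first one
if `n` is odd. -/
abbrev Cols (n : ℕ) : Type := {j : Fin n // Even n ∨ (j : ℕ) ≠ 0}

/-- `W` for even `n`; `W` without its first column, `[Ae, …, Aⁿ⁻¹e]`, for odd `n`. -/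
noncomputable def walkHat {n : ℕ} (G : SimpleGraph (Fin n)) : Matrix (Fin n) (Cols n) ℤ :=
  (walkMatrix G).submatrix id Subtype.val

/-- `W₁` for even `n`; `W₁` without its first column, `[A²e, …, A²ⁿ⁻²e]`, for odd `n`. -/
noncomputable def walkSqHat {n : ℕ} (G : SimpleGraph (Fin n)) : Matrix (Fin n) (Cols n) ℤ :=
  (walkMatrixSq G).submatrix id Subtype.val

/-- The integer matrix `Wᵀ W₁ / 2` (with `W₁` without its first column if `n` is odd). The division
is exact, see `two_smul_halfGram`. -/
noncomputable def halfGram {n : ℕ} (G : SimpleGraph (Fin n)) : Matrix (Fin n) (Cols n) ℤ :=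
  ((walkMatrix G)ᵀ * walkSqHat G).map (fun z => z / 2)

/-- `{x | (Wᵀ W₁ / 2) x ≡ 0 (mod 2)} ⊆ {x | W x ≡ 0 (mod 2)}`, where for odd `n` the first columns
of `W₁` and of the right-hand `W` are deleted. -/
def KernelCondition {n : ℕ} (G : SimpleGraph (Fin n)) : Prop :=
  {x : Cols n → ZMod 2 | mod2 (halfGram G) *ᵥ x = 0} ⊆
    {x : Cols n → ZMod 2 | mod2 (walkHat G) *ᵥ x = 0}

theorem sum_symm_mod2 {n : ℕ} (M : Matrix (Fin n) (Fin n) (ZMod 2)) (h : M.IsSymm) :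
    ∑ i, ∑ j, M i j = ∑ i, M i i := by
  have h0 : ∑ p : Fin n × Fin n, (if p.1 = p.2 then 0 else M p.1 p.2) = 0 := by
    refine Finset.sum_involution (fun p _ => p.swap) ?_ ?_ (by simp) (by simp)
    · rintro ⟨i, j⟩ -
      have hij : M j i = M i j := h.apply i j
      by_cases hh : i = j
      · simp [hh]
      · simp [hh, Ne.symm hh, hij, CharTwo.add_self_eq_zero]
    · rintro ⟨i, j⟩ - hne heq
      simp only [Prod.swap_prod_mk, Prod.mk.injEq] at heq
      simp [heq.2] at hne
  rw [Fintype.sum_prod_type] at h0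
  rw [← sub_eq_zero, ← h0, ← Finset.sum_sub_distrib]
  refine Finset.sum_congr rfl fun i _ => ?_
  have : M i i = ∑ j, (if i = j then M i j else 0) := by simp
  rw [this, ← Finset.sum_sub_distrib]
  refine Finset.sum_congr rfl fun j _ => ?_
  by_cases hh : i = j <;> simp [hh]

theorem adj_isSymm {n : ℕ} (G : SimpleGraph (Fin n)) : (adj ℤ G).IsSymm := by
  classical exact G.isSymm_adjMatrix

theorem adj_diag {n : ℕ} (G : SimpleGraph (Fin n)) (i : Fin n) : adj ℤ G i i = 0 := by
  classical simp [adj]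

theorem even_sum_pow {n : ℕ} (G : SimpleGraph (Fin n)) (l : ℕ) :
    (2 : ℤ) ∣ ∑ i, ∑ j, (adj ℤ G ^ (l + 1)) i j := by
  refine (ZMod.intCast_zmod_eq_zero_iff_dvd _ 2).1 ?_
  have hs : ∀ k i j, (adj ℤ G ^ k) j i = (adj ℤ G ^ k) i j := fun k =>
    ((adj_isSymm G).pow k).apply
  have h1 := sum_symm_mod2 (mod2 (adj ℤ G ^ (l + 1))) (by
    ext i j; simp [mod2, hs (l + 1) i j])
  have h2 := sum_symm_mod2 (mod2 (Matrix.of fun i j => adj ℤ G i j * (adj ℤ G ^ l) i j)) (by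
    ext i j; simp [mod2, hs l i j, (adj_isSymm G).apply i j])
  simp only [mod2, Matrix.map_apply, Matrix.of_apply, adj_diag, zero_mul, Int.cast_zero,
    Finset.sum_const_zero] at h1 h2
  push_cast
  rw [h1, ← h2]
  refine Finset.sum_congr rfl fun i _ => ?_
  rw [pow_succ', Matrix.mul_apply, Int.cast_sum]
  refine Finset.sum_congr rfl fun j _ => ?_
  rw [hs l i j]

theorem two_smul_halfGram {n : ℕ} (G : SimpleGraph (Fin n)) :
    (2 : ℤ) • halfGram G = (walkMatrix G)ᵀ * walkSqHat G := by
  ext i j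
  have key : ((walkMatrix G)ᵀ * walkSqHat G) i j =
      ∑ a, ∑ b, (adj ℤ G ^ ((i : ℕ) + 2 * (j.1 : ℕ))) a b := by
    have e1 : ((walkMatrix G)ᵀ * walkSqHat G) i j =
        ((adj ℤ G ^ (i : ℕ)) *ᵥ 1) ⬝ᵥ ((adj ℤ G ^ (2 * (j.1 : ℕ))) *ᵥ 1) := rfl
    rw [e1, pow_add, ← ((adj_isSymm G).pow (i : ℕ)).eq, Matrix.mulVec_transpose,
      ← Matrix.dotProduct_mulVec, Matrix.mulVec_mulVec, ((adj_isSymm G).pow (i : ℕ)).eq]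
    simp [dotProduct, Matrix.mulVec]
  have hdvd : (2 : ℤ) ∣ ((walkMatrix G)ᵀ * walkSqHat G) i j := by
    rw [key]
    rcases Nat.eq_zero_or_pos ((i : ℕ) + 2 * (j.1 : ℕ)) with h | h
    · have hn : Even n := by
        rcases j.2 with h' | h'
        · exact h'
        · omega
      rw [h]
      simp only [pow_zero, Matrix.one_apply, Finset.sum_ite_eq, Finset.mem_univ, if_true,
        Finset.sum_const, Finset.card_univ, Fintype.card_fin, nsmul_eq_mul, mul_one]
      exact_mod_cast hn.two_dvd
    · obtain ⟨k, hk⟩ := Nat.exists_eq_add_of_lt h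
      rw [hk, zero_add]
      exact even_sum_pow G k
  rw [Matrix.smul_apply, halfGram, Matrix.map_apply, smul_eq_mul]
  exact Int.mul_ediv_cancel' hdvd

end GenSpec

/-! Equal generalized spectra give equal walk counts `eᵀAᵏe`. With `W_G` invertible, `Q = W_G W_H⁻¹`
is then a rational orthogonal matrix with `Qe = e` and `QᵀAQ` the adjacency matrix of `H`. Write `Q
= M / l` with `M` integral and `|l|` minimal. If `l = ±1`, then `Q` is a permutation matrix and the
graphs are isomorphic, so it remains to exclude every prime `p ∣ l`.

By minimality some column `u` of `M` is nonzero mod `p`, while `eᵀAᵏu ≡ 0 (mod p)` and `uᵀAᵏu ≡ 0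
(mod p²)` for all `k`. For `p = 2` (`two_dvd_of_kernelCondition`), the rank condition puts `u` in
the column space of `Ŵ` mod 2, say `u ≡ Ŵy`. The congruences mod 4 say exactly that `y` lies in the
kernel of `½WᵀŴ₁` mod 2, so the kernel condition gives `u ≡ 0`. For odd `p` (`dvd_of_odd_prime`),
the Smith form gives `W` corank at most one mod `p`, so `u` is an eigenvector of `A` mod `p`. It
lifts to `v ≡ u (mod p)` with `Wᵀv ≡ 0 (mod p²)`. As no invariant factor is divisible by `p²`, this
forces `u ≡ 0`. -/

/-! ### Walk generating functions and characteristic polynomials -/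

open Matrix PowerSeries in
theorem Matrix.one_sub_X_smul_mul_mk_pow {F ι : Type} [CommRing F] [Fintype ι] [DecidableEq ι]
    (A : Matrix ι ι F) :
    (1 - (PowerSeries.X : F⟦X⟧) • A.map (PowerSeries.C (R := F))) *
      (Matrix.of fun i j => PowerSeries.mk fun k => (A ^ k) i j) = 1 := by
  rw [sub_mul, one_mul, sub_eq_iff_eq_add]
  ext i j k
  cases k with
  | zero => by_cases hij : i = j <;> simp [Matrix.mul_apply, hij]
  | succ k =>
    rw [smul_mul_assoc, Matrix.add_apply, Matrix.smul_apply, map_add, smul_eq_mul,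
      PowerSeries.coeff_succ_X_mul]
    simp [Matrix.mul_apply, Matrix.one_apply, pow_succ', apply_ite, PowerSeries.coeff_one]

open Matrix in
theorem Matrix.det_scalar_sub_eq_of_charpoly_eq {F K ι : Type} [CommRing F] [CommRing K]
    [Fintype ι] [DecidableEq ι] (f : F →+* K) {A B : Matrix ι ι F} (h : A.charpoly = B.charpoly)
    (x : K) : (Matrix.scalar ι x - A.map f).det = (Matrix.scalar ι x - B.map f).det := by
  rw [← Matrix.eval_charpoly, ← Matrix.eval_charpoly, Matrix.charpoly_map, Matrix.charpoly_map, h]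

-- The all-one matrix is the rank-one product `e eᵀ`, so this is the matrix determinant lemma with
-- `N` as the inverse of `M`.
open Matrix in
theorem Matrix.det_add_all_ones {K ι : Type} [CommRing K] [Fintype ι] [DecidableEq ι]
    {M N : Matrix ι ι K} (h : M * N = 1) :
    (M + Matrix.of fun _ _ => 1).det = M.det * (1 + 1 ⬝ᵥ (N *ᵥ 1)) := by
  rw [← Matrix.det_one_add_replicateCol_mul_replicateRow (ι := Unit), ← Matrix.det_mul, mul_add,
    mul_one, ← Matrix.mul_assoc, Matrix.replicateCol_mulVec, ← Matrix.mul_assoc, h, Matrix.one_mul]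
  congr 2
  ext i j
  simp [Matrix.mul_apply]

open Matrix in
/-- The numbers of walks are determined by the characteristic polynomials of `A` and of
`J - 1 - A`. -/
theorem Matrix.one_dotProduct_pow_mulVec_one_eq {F ι : Type} [Field F] [Fintype ι] [DecidableEq ι]
    {A B : Matrix ι ι F} (h : A.charpoly = B.charpoly)
    (hc : ((Matrix.of fun _ _ => 1) - 1 - A).charpoly =
      ((Matrix.of fun _ _ => 1) - 1 - B).charpoly) (k : ℕ) :
    1 ⬝ᵥ ((A ^ k) *ᵥ 1) = 1 ⬝ᵥ ((B ^ k) *ᵥ 1) := by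
  -- Here `X` becomes an invertible `t`, so `t⁻¹ - A` has inverse `t ∑ Aᵏtᵏ`, and characteristic
  -- polynomials can be evaluated at `t⁻¹`.
  let K := FractionRing (PowerSeries F)
  let g : PowerSeries F →+* K := algebraMap _ _
  have hg : Function.Injective g := IsFractionRing.injective _ _
  let f : F →+* K := g.comp PowerSeries.C
  let S : Matrix ι ι F → Matrix ι ι (PowerSeries F) :=
    fun A => Matrix.of fun i j => PowerSeries.mk fun k => (A ^ k) i j
  let t : K := g PowerSeries.X
  have ht : t ≠ 0 := (map_ne_zero_iff g hg).2 PowerSeries.X_ne_zero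
  have hinv : ∀ A : Matrix ι ι F, (Matrix.scalar ι t⁻¹ - A.map f) * (t • (S A).map g) = 1 := by
    intro A
    have h1 := congrArg (fun M => M.map g) (Matrix.one_sub_X_smul_mul_mk_pow A)
    simp only [Matrix.map_mul] at h1
    rw [Matrix.map_one _ (map_zero g) (map_one g)] at h1
    rw [← h1, Matrix.mul_smul, ← Matrix.smul_mul]
    congr 1
    ext i j
    by_cases hij : i = j
    · simp [Matrix.scalar_apply, hij, f, mul_sub, ht, t]
    · simp [Matrix.scalar_apply, hij, f, t]
      exact mul_neg _ _
  -- `t⁻¹ - A + J = -((-t⁻¹ - 1) - (J - 1 - A))`, so the perturbed determinant is a value of the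
  -- complement's characteristic polynomial.
  have hcompl : ∀ A : Matrix ι ι F, (Matrix.scalar ι t⁻¹ - A.map f + Matrix.of fun _ _ => 1).det =
      (-1) ^ Fintype.card ι * (Matrix.scalar ι (-t⁻¹ - 1) -
        ((Matrix.of fun _ _ => 1) - 1 - A).map f).det := by
    intro A
    rw [← Matrix.det_neg]
    congr 1
    ext i j
    by_cases hij : i = j <;>
      simp [Matrix.scalar_apply, hij] <;> ring
  have hdet : ∀ A : Matrix ι ι F, (Matrix.scalar ι t⁻¹ - A.map f).det ≠ 0 := fun A h0 => by
    have := congrArg Matrix.det (hinv A)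
    rw [Matrix.det_mul, h0, zero_mul, Matrix.det_one] at this
    exact zero_ne_one this
  have key : 1 ⬝ᵥ ((t • (S A).map g) *ᵥ 1) = 1 ⬝ᵥ ((t • (S B).map g) *ᵥ 1) := by
    have h1 := Matrix.det_add_all_ones (hinv A)
    rw [hcompl, Matrix.det_scalar_sub_eq_of_charpoly_eq f hc, ← hcompl,
      Matrix.det_add_all_ones (hinv B), Matrix.det_scalar_sub_eq_of_charpoly_eq f h] at h1
    exact (add_left_cancel (mul_left_cancel₀ (hdet B) h1)).symm
  have hS : ∀ A : Matrix ι ι F,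
      1 ⬝ᵥ ((t • (S A).map g) *ᵥ 1) = t * g (1 ⬝ᵥ (S A *ᵥ 1)) := by
    intro A
    simp only [Matrix.smul_mulVec, dotProduct_smul, smul_eq_mul]
    simp [Matrix.mulVec, dotProduct]
  rw [hS, hS] at key
  have h2 := congrArg (PowerSeries.coeff k) (hg (mul_left_cancel₀ ht key))
  simpa [Matrix.mulVec, dotProduct, S] using h2

/-! ### Walk counts as invariants of the generalized spectrum -/

namespace GenSpec
open Matrix

theorem adj_apply {V R : Type} [Zero R] [One R] (G : SimpleGraph V) (i j : V)
    [Decidable (G.Adj i j)] : adj R G i j = if G.Adj i j then 1 else 0 := by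
  classical
  simp [adj, SimpleGraph.adjMatrix_apply]

theorem charpoly_eq_prod_spec {n : ℕ} (G : SimpleGraph (Fin n)) :
    (adj ℂ G).charpoly = ((spec G).map fun a => Polynomial.X - Polynomial.C a).prod :=
  (IsAlgClosed.splits _).eq_prod_roots_of_monic (Matrix.charpoly_monic _)

theorem card_spec {n : ℕ} (G : SimpleGraph (Fin n)) : (spec G).card = n := by
  rw [spec, (Polynomial.splits_iff_card_roots.1 (IsAlgClosed.splits _)),
    Matrix.charpoly_natDegree_eq_dim, Fintype.card_fin]

theorem adj_compl {n : ℕ} (G : SimpleGraph (Fin n)) :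
    adj ℂ Gᶜ = (Matrix.of fun _ _ => 1) - 1 - adj ℂ G := by
  classical
  ext i j
  by_cases hij : i = j
  · simp [adj_apply, hij]
  · by_cases h : G.Adj i j <;> simp [adj_apply, hij, h]

/-- The number of walks of length `k` in `G`. -/
noncomputable def walkCount {n : ℕ} (G : SimpleGraph (Fin n)) (k : ℕ) : ℤ :=
  1 ⬝ᵥ ((adj ℤ G ^ k) *ᵥ 1)

theorem map_adj {n : ℕ} (R : Type) [CommRing R] (G : SimpleGraph (Fin n)) :
    (adj ℤ G).map (Int.castRingHom R) = adj R G := by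
  classical
  ext i j
  by_cases h : G.Adj i j <;> simp [adj_apply, h]

theorem cast_walkCount {n : ℕ} (R : Type) [CommRing R] (G : SimpleGraph (Fin n)) (k : ℕ) :
    (walkCount G k : R) = 1 ⬝ᵥ ((adj R G ^ k) *ᵥ 1) := by
  rw [← map_adj, ← Matrix.map_pow]
  simp [walkCount, dotProduct, Matrix.mulVec]

theorem SameGenSpec.walkCount_eq {n : ℕ} {G H : SimpleGraph (Fin n)} (h : SameGenSpec G H) (k : ℕ) :
    walkCount G k = walkCount H k := by
  have := Matrix.one_dotProduct_pow_mulVec_one_eq (A := adj ℂ G) (B := adj ℂ H)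
    (by rw [charpoly_eq_prod_spec, charpoly_eq_prod_spec, h.1])
    (by rw [← adj_compl, ← adj_compl, charpoly_eq_prod_spec, charpoly_eq_prod_spec, h.2]) k
  rw [← cast_walkCount, ← cast_walkCount] at this
  exact_mod_cast this

theorem walkMatrix_transpose_mulVec {n : ℕ} (G : SimpleGraph (Fin n)) (v : Fin n → ℤ) (i : Fin n) :
    ((walkMatrix G)ᵀ *ᵥ v) i = (adj ℤ G ^ (i : ℕ) *ᵥ 1) ⬝ᵥ v := rfl

theorem pow_dotProduct_pow {n : ℕ} (G : SimpleGraph (Fin n)) (a b : ℕ) (v : Fin n → ℤ) :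
    (adj ℤ G ^ a *ᵥ 1) ⬝ᵥ (adj ℤ G ^ b *ᵥ v) = (adj ℤ G ^ (a + b) *ᵥ 1) ⬝ᵥ v := by
  rw [add_comm, pow_add, ← Matrix.mulVec_mulVec, Matrix.dotProduct_mulVec,
    ← Matrix.mulVec_transpose, ((adj_isSymm G).pow b).eq]

theorem pow_dotProduct_pow_one {n : ℕ} (G : SimpleGraph (Fin n)) (a b : ℕ) :
    (adj ℤ G ^ a *ᵥ 1) ⬝ᵥ (adj ℤ G ^ b *ᵥ 1) = walkCount G (a + b) := by
  rw [pow_dotProduct_pow, dotProduct_comm, walkCount]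

theorem walkMatrix_gram {n : ℕ} (G : SimpleGraph (Fin n)) (k : ℕ) :
    (walkMatrix G)ᵀ * (adj ℤ G ^ k * walkMatrix G) =
      Matrix.of fun i j : Fin n => walkCount G (i + (k + j)) := by
  ext i j
  have : ((walkMatrix G)ᵀ * (adj ℤ G ^ k * walkMatrix G)) i j =
    (adj ℤ G ^ (i : ℕ) *ᵥ 1) ⬝ᵥ (adj ℤ G ^ k *ᵥ (adj ℤ G ^ (j : ℕ) *ᵥ 1)) := rfl
  rw [this, Matrix.mulVec_mulVec, ← pow_add, pow_dotProduct_pow_one]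
  rfl

theorem walkMatrix_transpose_mulVec_pow {n : ℕ} (G : SimpleGraph (Fin n)) (k : ℕ) :
    (walkMatrix G)ᵀ *ᵥ (adj ℤ G ^ k *ᵥ 1) = fun i : Fin n => walkCount G (i + k) := by
  ext i
  rw [walkMatrix_transpose_mulVec, pow_dotProduct_pow_one]

/-! ### The integral conjugating matrix and its level -/

/-- `M` is `l` times an orthogonal matrix which fixes the all-one vector and conjugates the
adjacency matrix of `G` to the one of `H`. -/
def IsScaledConjugator {n : ℕ} (G H : SimpleGraph (Fin n)) (M : Matrix (Fin n) (Fin n) ℤ) (l : ℤ) :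
    Prop :=
  ∀ k : ℕ, Mᵀ * (adj ℤ G ^ k * M) = l ^ 2 • adj ℤ H ^ k ∧
    Mᵀ *ᵥ (adj ℤ G ^ k *ᵥ 1) = l • (adj ℤ H ^ k *ᵥ 1)

/-- The matrices `WᵀAᵏW` have walk counts as entries, so they agree for `G` and `H`; the case `k =
0` makes `W_H` invertible too. The witness is `W_G W_H⁻¹`, cleared of denominators by `det W_H`. -/
theorem exists_isScaledConjugator {n : ℕ} {G H : SimpleGraph (Fin n)}
    (h : ∀ k, walkCount G k = walkCount H k) (hG : Controllable G) :
    ∃ M : Matrix (Fin n) (Fin n) ℤ, ∃ l : ℤ, l ≠ 0 ∧ IsScaledConjugator G H M l := by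
  have hgram : ∀ k, (walkMatrix G)ᵀ * (adj ℤ G ^ k * walkMatrix G) =
      (walkMatrix H)ᵀ * (adj ℤ H ^ k * walkMatrix H) := fun k => by
    rw [walkMatrix_gram, walkMatrix_gram]
    simp only [h]
  refine ⟨walkMatrix G * (walkMatrix H).adjugate, (walkMatrix H).det, fun h0 => ?_,
    fun k => ⟨?_, ?_⟩⟩
  · have h1 := congrArg Matrix.det (hgram 0)
    simp only [pow_zero, Matrix.one_mul, Matrix.det_mul, Matrix.det_transpose, h0, mul_zero] at h1
    exact hG (mul_self_eq_zero.1 h1)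
  · have h2 : (walkMatrix H * (walkMatrix H).adjugate)ᵀ = (walkMatrix H).det • 1 := by
      rw [Matrix.mul_adjugate]; simp
    calc (walkMatrix G * (walkMatrix H).adjugate)ᵀ *
          (adj ℤ G ^ k * (walkMatrix G * (walkMatrix H).adjugate))
        = (walkMatrix H).adjugateᵀ * ((walkMatrix G)ᵀ * (adj ℤ G ^ k * walkMatrix G)) *
          (walkMatrix H).adjugate := by simp only [Matrix.transpose_mul, Matrix.mul_assoc]
      _ = (walkMatrix H * (walkMatrix H).adjugate)ᵀ *
          (adj ℤ H ^ k * (walkMatrix H * (walkMatrix H).adjugate)) := by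
        rw [hgram]; simp only [Matrix.transpose_mul, Matrix.mul_assoc]
      _ = (walkMatrix H).det ^ 2 • adj ℤ H ^ k := by
        rw [h2, Matrix.mul_adjugate]
        simp only [Matrix.smul_mul, Matrix.mul_smul, Matrix.one_mul, Matrix.mul_one, smul_smul, sq]
  · have h2 : (walkMatrix H * (walkMatrix H).adjugate)ᵀ = (walkMatrix H).det • 1 := by
      rw [Matrix.mul_adjugate]; simp
    rw [Matrix.transpose_mul, ← Matrix.mulVec_mulVec, walkMatrix_transpose_mulVec_pow]
    simp only [h]
    rw [← walkMatrix_transpose_mulVec_pow, Matrix.mulVec_mulVec, ← Matrix.transpose_mul, h2]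
    rw [Matrix.smul_mulVec, Matrix.one_mulVec]

/-- A scaled conjugator with `l` of minimal absolute value: no prime divides `l` and `M`. -/
theorem exists_primitive_isScaledConjugator {n : ℕ} {G H : SimpleGraph (Fin n)}
    (h : ∀ k, walkCount G k = walkCount H k) (hG : Controllable G) :
    ∃ M : Matrix (Fin n) (Fin n) ℤ, ∃ l : ℤ, l ≠ 0 ∧ IsScaledConjugator G H M l ∧
      ∀ p : ℕ, p.Prime → (p : ℤ) ∣ l → ∃ i j, ¬ (p : ℤ) ∣ M i j := by
  have hex : ∃ a : ℕ, ∃ M : Matrix (Fin n) (Fin n) ℤ, ∃ l : ℤ, l ≠ 0 ∧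
      IsScaledConjugator G H M l ∧ l.natAbs = a := by
    obtain ⟨M, l, hl, hM⟩ := exists_isScaledConjugator h hG
    exact ⟨_, M, l, hl, hM, rfl⟩
  classical
  obtain ⟨M, l, hl, hM, hla⟩ := Nat.find_spec hex
  refine ⟨M, l, hl, hM, fun p hp hpl => ?_⟩
  by_contra! hdiv
  obtain ⟨m, rfl⟩ := hpl
  choose N hN using hdiv
  have hp0 : (p : ℤ) ≠ 0 := by exact_mod_cast hp.ne_zero
  obtain rfl : M = (p : ℤ) • Matrix.of N := by
    ext i j
    simpa using hN i j
  have hm : m ≠ 0 := right_ne_zero_of_mul hl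
  refine Nat.find_min hex (m := m.natAbs) ?_ ⟨Matrix.of N, m, hm, fun k => ⟨?_, ?_⟩, rfl⟩
  · rw [← hla, Int.natAbs_mul, Int.natAbs_natCast]
    have := Int.natAbs_pos.2 hm
    nlinarith [hp.two_le]
  · have := (hM k).1
    refine smul_right_injective _ (pow_ne_zero 2 hp0) ?_
    simp only [Matrix.transpose_smul, Matrix.smul_mul, Matrix.mul_smul, smul_smul] at this
    simpa only [smul_smul, mul_pow, ← sq] using this
  · have := (hM k).2
    refine smul_right_injective _ hp0 ?_
    simpa only [Matrix.transpose_smul, Matrix.smul_mulVec, mul_smul] using this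

/-- Each column has entry sum and sum of squares 1, so `∑ x (x - 1) = 0`. For integers every term is
nonnegative, hence all entries are 0 or 1 and `M` is a permutation matrix. -/
theorem IsScaledConjugator.nonempty_iso {n : ℕ} {G H : SimpleGraph (Fin n)}
    {M : Matrix (Fin n) (Fin n) ℤ} (hM : IsScaledConjugator G H M 1) : Nonempty (G ≃g H) := by
  classical
  have h1 : Mᵀ * M = 1 := by simpa using (hM 0).1
  have h2 : Mᵀ *ᵥ 1 = 1 := by simpa using (hM 0).2
  have h3 : Mᵀ * (adj ℤ G * M) = adj ℤ H := by simpa using (hM 1).1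
  have hcol : ∀ j, ∑ i, M i j * (M i j - 1) = 0 := by
    intro j
    have a := congrFun (congrFun h1 j) j
    have b := congrFun h2 j
    simp only [Matrix.mul_apply, Matrix.transpose_apply, Matrix.one_apply_eq] at a
    simp only [Matrix.mulVec, dotProduct, Matrix.transpose_apply, Pi.one_apply, mul_one] at b
    simp only [mul_sub, mul_one, Finset.sum_sub_distrib, a, b, sub_self]
  have h01 : ∀ i j, M i j = 0 ∨ M i j = 1 := by
    intro i j
    have := (Finset.sum_eq_zero_iff_of_nonneg fun i _ => ?_).1 (hcol j) i (Finset.mem_univ i)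
    · rcases mul_eq_zero.1 this with h | h
      · exact Or.inl h
      · exact Or.inr (by linarith)
    · rcases le_or_gt (M i j) 0 with h | h
      · nlinarith
      · exact mul_nonneg h.le (by linarith [Int.add_one_le_iff.2 h])
  have hex : ∀ j, ∃ i, M i j = 1 := by
    intro j
    by_contra! hne
    have b := congrFun h2 j
    simp only [Matrix.mulVec, dotProduct, Matrix.transpose_apply, Pi.one_apply, mul_one] at b
    rw [Finset.sum_eq_zero fun i _ => (h01 i j).resolve_right (hne i)] at b
    exact zero_ne_one b
  choose σ hσ using hex
  have huniq : ∀ i j, M i j = if i = σ j then 1 else 0 := by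
    intro i j
    split_ifs with hij
    · rw [hij, hσ]
    · refine (h01 i j).resolve_right fun hi => ?_
      have b := congrFun h2 j
      simp only [Matrix.mulVec, dotProduct, Matrix.transpose_apply, Pi.one_apply, mul_one] at b
      have hle := Finset.sum_le_univ_sum_of_nonneg (s := {i, σ j}) (f := fun i => M i j)
        fun i => (h01 i j).elim (fun h => h.ge) (fun h => by rw [h]; exact zero_le_one)
      rw [Finset.sum_pair hij, b, hi, hσ] at hle
      norm_num at hle
  have hinj : Function.Injective σ := by
    intro j k hjk
    by_contra hne
    have a := congrFun (congrFun h1 j) k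
    simp [Matrix.mul_apply, huniq, hjk, Matrix.one_apply_ne hne] at a
  have hadj : ∀ j k, adj ℤ G (σ j) (σ k) = adj ℤ H j k := by
    intro j k
    rw [← h3]
    simp [Matrix.mul_apply, huniq]
  refine ⟨(RelIso.mk (Equiv.ofBijective σ (Finite.injective_iff_bijective.1 hinj)) ?_ :
    H ≃g G).symm⟩
  intro j k
  have := hadj j k
  rw [adj_apply, adj_apply] at this
  change G.Adj (σ j) (σ k) ↔ H.Adj j k
  by_cases ha : G.Adj (σ j) (σ k) <;> by_cases hb : H.Adj j k <;> simp_all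

theorem IsScaledConjugator.neg {n : ℕ} {G H : SimpleGraph (Fin n)}
    {M : Matrix (Fin n) (Fin n) ℤ} {l : ℤ} (hM : IsScaledConjugator G H M l) :
    IsScaledConjugator G H (-M) (-l) := by
  intro k
  rw [Matrix.transpose_neg, Matrix.neg_mulVec, (hM k).2, neg_smul, Matrix.mul_neg,
    Matrix.neg_mul, Matrix.mul_neg, neg_neg, (hM k).1, neg_sq]
  exact ⟨rfl, rfl⟩

/-- The properties of a column of a scaled conjugator. -/
theorem IsScaledConjugator.col {n : ℕ} {G H : SimpleGraph (Fin n)}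
    {M : Matrix (Fin n) (Fin n) ℤ} {l : ℤ} (hM : IsScaledConjugator G H M l) (j : Fin n) (k : ℕ) :
    l ∣ (adj ℤ G ^ k *ᵥ 1) ⬝ᵥ M.col j ∧ l ^ 2 ∣ M.col j ⬝ᵥ (adj ℤ G ^ k *ᵥ M.col j) := by
  constructor
  · refine ⟨(adj ℤ H ^ k *ᵥ 1) j, ?_⟩
    have := congrFun (hM k).2 j
    rw [dotProduct_comm]
    exact this
  · exact ⟨(adj ℤ H ^ k) j j, congrFun (congrFun (hM k).1 j) j⟩

/-! ### The prime 2 -/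

theorem even_walkCount {n : ℕ} (G : SimpleGraph (Fin n)) {k : ℕ} (hk : Even n ∨ k ≠ 0) :
    (2 : ℤ) ∣ walkCount G k := by
  cases k with
  | zero =>
    have hn : Even n := hk.resolve_right (by simp)
    simp only [walkCount, pow_zero, Matrix.one_mulVec, dotProduct, Pi.one_apply, mul_one,
      Finset.sum_const, Finset.card_univ, Fintype.card_fin, nsmul_eq_mul]
    exact_mod_cast hn.two_dvd
  | succ k =>
    have := even_sum_pow G k
    simpa [walkCount, dotProduct, Matrix.mulVec] using this

theorem mod2_mul {α β γ : Type} [Fintype β] (M : Matrix α β ℤ) (N : Matrix β γ ℤ) :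
    mod2 (M * N) = mod2 M * mod2 N :=
  Matrix.map_mul (f := Int.castRingHom (ZMod 2))

theorem mod2_mulVec {α β : Type} [Fintype β] (M : Matrix α β ℤ) (x : β → ℤ) :
    mod2 M *ᵥ (fun j => (x j : ZMod 2)) = fun i => ((M *ᵥ x) i : ZMod 2) := by
  ext i
  simp [mod2, Matrix.mulVec, dotProduct]

theorem mod2_walkMatrix_transpose_mul_walkHat {n : ℕ} (G : SimpleGraph (Fin n)) :
    mod2 (walkMatrix G)ᵀ * mod2 (walkHat G) = 0 := by
  rw [← mod2_mul]
  ext i j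
  have : ((walkMatrix G)ᵀ * walkHat G) i j = walkCount G (i + j.1) :=
    pow_dotProduct_pow_one G _ _
  rw [mod2, Matrix.map_apply, this]
  refine (ZMod.intCast_zmod_eq_zero_iff_dvd _ 2).2 (even_walkCount G ?_)
  exact j.2.imp_right fun h => by omega

theorem le_rank_mod2_walkHat {n : ℕ} (G : SimpleGraph (Fin n)) :
    rank2 (walkMatrix G) ≤ (mod2 (walkHat G)).rank + n % 2 := by
  rw [rank2, Matrix.rank_eq_finrank_span_cols, Matrix.rank_eq_finrank_span_cols]
  have hcol : ∀ j : Cols n, (mod2 (walkMatrix G)).col j.1 = (mod2 (walkHat G)).col j :=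
    fun j => rfl
  rcases Nat.even_or_odd n with hn | hn
  · refine le_trans (Submodule.finrank_mono (Submodule.span_mono ?_)) (Nat.le_add_right _ _)
    rintro _ ⟨j, rfl⟩
    exact ⟨⟨j, Or.inl hn⟩, rfl⟩
  · have hle : Submodule.span (ZMod 2) (Set.range (mod2 (walkMatrix G)).col) ≤
        Submodule.span (ZMod 2) (Set.range (mod2 (walkHat G)).col) ⊔
          Submodule.span (ZMod 2) {(mod2 (walkMatrix G)).col ⟨0, hn.pos⟩} := by
      rw [Submodule.span_le]
      rintro _ ⟨j, rfl⟩
      by_cases hj : (j : ℕ) = 0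
      · obtain rfl : j = ⟨0, hn.pos⟩ := Fin.ext hj
        exact Submodule.mem_sup_right (Submodule.mem_span_singleton_self _)
      · exact Submodule.mem_sup_left (Submodule.subset_span ⟨⟨j, Or.inr hj⟩, rfl⟩)
    refine (Submodule.finrank_mono hle).trans ((Submodule.finrank_add_le_finrank_add_finrank _ _).trans ?_)
    rw [Nat.odd_iff.1 hn]
    exact Nat.add_le_add_left ((finrank_span_le_card _).trans (by simp)) _

/-- Walk counts are even, which gives one inclusion. The kernel has dimension `n - ⌈n/2⌉ = ⌊n/2⌋`,
and deleting a column for odd `n` lowers the rank `⌈n/2⌉` by at most one, so the range is at least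
as large. -/
theorem range_mod2_walkHat {n : ℕ} (G : SimpleGraph (Fin n))
    (hrank : rank2 (walkMatrix G) = (n + 1) / 2) :
    LinearMap.range (mod2 (walkHat G)).mulVecLin =
      LinearMap.ker (mod2 (walkMatrix G)ᵀ).mulVecLin := by
  refine Submodule.eq_of_le_of_finrank_le ?_ ?_
  · rintro _ ⟨x, rfl⟩
    rw [LinearMap.mem_ker, Matrix.mulVecLin_apply, Matrix.mulVecLin_apply, Matrix.mulVec_mulVec,
      mod2_walkMatrix_transpose_mul_walkHat, Matrix.zero_mulVec]
  · have h1 := (mod2 (walkMatrix G)ᵀ).mulVecLin.finrank_range_add_finrank_ker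
    have h2 : Module.finrank (ZMod 2) (LinearMap.range (mod2 (walkMatrix G)ᵀ).mulVecLin) =
        (n + 1) / 2 := by
      rw [← hrank, rank2, ← Matrix.rank_transpose]
      rfl
    rw [h2, Module.finrank_fin_fun] at h1
    have h3 := le_rank_mod2_walkHat G
    rw [hrank] at h3
    change _ ≤ (mod2 (walkHat G)).rank
    omega

/-- A quadratic form over `𝔽₂` with symmetric coefficients only sees its diagonal. -/
theorem sum_symm_mul_mul {ι : Type} [Fintype ι] (d : ι → ι → ZMod 2) (hd : ∀ i j, d i j = d j i)
    (x : ι → ZMod 2) : ∑ i, ∑ j, x i * (x j * d i j) = ∑ i, d i i * x i := by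
  let e := (Fintype.equivFin ι).symm
  have h := sum_symm_mod2 (Matrix.of fun i j => x (e i) * (x (e j) * d (e i) (e j))) (by
    ext i j
    simp only [Matrix.transpose_apply, Matrix.of_apply, hd (e j) (e i)]
    ring)
  have hsq : ∀ a : ZMod 2, a * a = a := by decide
  simp only [Matrix.of_apply, ← mul_assoc, hsq] at h
  simp only [← mul_assoc]
  rw [← e.sum_comp, ← e.sum_comp fun i => d i i * x i]
  rw [Finset.sum_congr rfl fun i _ => mul_comm (d (e i) (e i)) (x (e i)), ← h]
  exact Finset.sum_congr rfl fun i _ => (e.sum_comp fun j => x (e i) * x j * d (e i) j).symm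

theorem walkHat_mulVec {n : ℕ} (G : SimpleGraph (Fin n)) (y : Cols n → ℤ) :
    walkHat G *ᵥ y = ∑ j, y j • (adj ℤ G ^ (j.1 : ℕ) *ᵥ 1) := by
  ext i
  rw [Finset.sum_apply, Matrix.mulVec, dotProduct]
  exact Finset.sum_congr rfl fun j _ => mul_comm _ _

theorem walkHat_quadratic {n : ℕ} (G : SimpleGraph (Fin n)) (y : Cols n → ℤ) (k : ℕ) :
    (walkHat G *ᵥ y) ⬝ᵥ (adj ℤ G ^ k *ᵥ (walkHat G *ᵥ y)) =
      ∑ i, ∑ j, y i * (y j * walkCount G (i.1 + (k + j.1))) := by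
  rw [walkHat_mulVec, Matrix.mulVec_sum, sum_dotProduct]
  refine Finset.sum_congr rfl fun i _ => ?_
  rw [dotProduct_sum]
  refine Finset.sum_congr rfl fun j _ => ?_
  rw [Matrix.mulVec_smul, smul_dotProduct, dotProduct_smul, Matrix.mulVec_mulVec, ← pow_add,
    pow_dotProduct_pow_one, smul_eq_mul, smul_eq_mul]

theorem two_mul_halfGram_apply {n : ℕ} (G : SimpleGraph (Fin n)) (k : Fin n) (j : Cols n) :
    2 * halfGram G k j = walkCount G (k + 2 * j.1) := by
  have := congrFun (congrFun (two_smul_halfGram G) k) j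
  rw [Matrix.smul_apply, smul_eq_mul] at this
  exact this.trans (pow_dotProduct_pow_one G _ _)

/-- The quadratic form in `y` has even symmetric coefficients. Half of it, taken mod 2, keeps only
its diagonal part `∑ ½ walkCount (k + 2j) yⱼ`, which is row `k` of `halfGram` applied to `y`. -/
theorem mod2_halfGram_mulVec_eq_zero {n : ℕ} (G : SimpleGraph (Fin n)) (y : Cols n → ℤ)
    (h : ∀ k, (4 : ℤ) ∣ (walkHat G *ᵥ y) ⬝ᵥ (adj ℤ G ^ k *ᵥ (walkHat G *ᵥ y))) :
    mod2 (halfGram G) *ᵥ (fun j => (y j : ZMod 2)) = 0 := by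
  have hex : ∀ (k : ℕ) (i j : Cols n), ∃ d : ℤ, walkCount G (i.1 + (k + j.1)) = 2 * d :=
    fun k i j => even_walkCount G (i.2.imp_right fun h => by omega)
  choose d hd using hex
  rw [mod2_mulVec]
  ext k
  have h4 := h k
  rw [walkHat_quadratic] at h4
  have h2 : ∑ i, ∑ j, y i * (y j * walkCount G (i.1 + (k + j.1))) =
      2 * ∑ i, ∑ j, y i * (y j * d k i j) := by
    simp only [hd, Finset.mul_sum]
    refine Finset.sum_congr rfl fun i _ => Finset.sum_congr rfl fun j _ => by ring
  rw [h2, show (4 : ℤ) = 2 * 2 by norm_num, mul_dvd_mul_iff_left two_ne_zero] at h4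
  have h5 := (ZMod.intCast_zmod_eq_zero_iff_dvd _ 2).2 h4
  push_cast at h5
  rw [sum_symm_mul_mul (fun i j => (d k i j : ZMod 2))] at h5
  · rw [Pi.zero_apply, ← h5]
    simp only [Matrix.mulVec, dotProduct]
    push_cast
    refine Finset.sum_congr rfl fun j _ => ?_
    congr 2
    have := two_mul_halfGram_apply G k j
    have h6 := hd k j j
    rw [show (j.1 : ℕ) + (k + j.1) = k + 2 * j.1 by ring, ← this] at h6
    linarith
  · intro i j
    congr 1
    have h6 := hd k i j
    have h7 := hd k j i
    rw [show (j.1 : ℕ) + (k + i.1) = i.1 + (k + j.1) by ring] at h7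
    linarith

theorem two_dvd_of_kernelCondition {n : ℕ} {G : SimpleGraph (Fin n)}
    (hrank : rank2 (walkMatrix G) = (n + 1) / 2) (hker : KernelCondition G) {u : Fin n → ℤ}
    (h1 : ∀ k, (2 : ℤ) ∣ (adj ℤ G ^ k *ᵥ 1) ⬝ᵥ u)
    (h2 : ∀ k, (4 : ℤ) ∣ u ⬝ᵥ (adj ℤ G ^ k *ᵥ u)) (i : Fin n) : (2 : ℤ) ∣ u i := by
  have hmem : (fun i => (u i : ZMod 2)) ∈ LinearMap.range (mod2 (walkHat G)).mulVecLin := by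
    rw [range_mod2_walkHat G hrank, LinearMap.mem_ker, Matrix.mulVecLin_apply, mod2_mulVec]
    ext k
    exact (ZMod.intCast_zmod_eq_zero_iff_dvd _ 2).2 (h1 k)
  obtain ⟨x, hx⟩ := hmem
  choose y hy using fun j => ZMod.intCast_surjective (x j)
  obtain rfl : (fun j => (y j : ZMod 2)) = x := funext hy
  rw [Matrix.mulVecLin_apply] at hx
  have hβ : ∀ i, ∃ b, u i - (walkHat G *ᵥ y) i = 2 * b := fun i => by
    refine (ZMod.intCast_zmod_eq_zero_iff_dvd _ 2).1 ?_
    rw [mod2_mulVec] at hx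
    rw [Int.cast_sub, ← congrFun hx i, sub_self]
  choose β hβ using hβ
  have hw : walkHat G *ᵥ y = u - (2 : ℤ) • β := by
    ext i
    have := hβ i
    simp only [Pi.sub_apply, Pi.smul_apply, smul_eq_mul]
    linarith
  -- Replacing `u` by `Ŵy = u - 2β` changes the form by a multiple of 4, because the two cross terms
  -- coincide by symmetry.
  have hzero := hker (mod2_halfGram_mulVec_eq_zero G y fun k => by
    have hsymm : β ⬝ᵥ (adj ℤ G ^ k *ᵥ u) = u ⬝ᵥ (adj ℤ G ^ k *ᵥ β) := by
      rw [Matrix.dotProduct_mulVec, ← Matrix.mulVec_transpose, ((adj_isSymm G).pow k).eq,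
        dotProduct_comm]
    have : (u - (2 : ℤ) • β) ⬝ᵥ (adj ℤ G ^ k *ᵥ (u - (2 : ℤ) • β)) =
        u ⬝ᵥ (adj ℤ G ^ k *ᵥ u) +
          4 * (β ⬝ᵥ (adj ℤ G ^ k *ᵥ β) - u ⬝ᵥ (adj ℤ G ^ k *ᵥ β)) := by
      simp only [Matrix.mulVec_sub, Matrix.mulVec_smul, sub_dotProduct, dotProduct_sub,
        smul_dotProduct, dotProduct_smul, smul_eq_mul, hsymm]
      ring
    rw [hw, this]
    exact dvd_add (h2 k) (dvd_mul_right _ _))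
  rw [Set.mem_ofPred_eq, hx] at hzero
  exact (ZMod.intCast_zmod_eq_zero_iff_dvd _ 2).1 (congrFun hzero i)

/-! ### Odd primes -/

theorem adj_pow_succ_dotProduct {n : ℕ} {R : Type} [CommRing R] (G : SimpleGraph (Fin n)) (k : ℕ)
    (v : Fin n → R) :
    (adj R G ^ (k + 1) *ᵥ 1) ⬝ᵥ v = (adj R G ^ k *ᵥ 1) ⬝ᵥ (adj R G *ᵥ v) := by
  have hs : (adj R G)ᵀ = adj R G := by
    classical exact G.isSymm_adjMatrix
  rw [pow_succ', ← Matrix.mulVec_mulVec, Matrix.dotProduct_mulVec, ← Matrix.mulVec_transpose, hs]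

theorem cast_adj_mulVec {n : ℕ} {R : Type} [CommRing R] (G : SimpleGraph (Fin n)) (k : ℕ)
    (v : Fin n → ℤ) :
    adj R G ^ k *ᵥ (fun i => (v i : R)) = fun i => ((adj ℤ G ^ k *ᵥ v) i : R) := by
  rw [← map_adj, ← Matrix.map_pow]
  ext i
  simp [Matrix.mulVec, dotProduct]

theorem cast_adj_dotProduct {n : ℕ} {R : Type} [CommRing R] (G : SimpleGraph (Fin n)) (k : ℕ)
    (v : Fin n → ℤ) :
    (adj R G ^ k *ᵥ 1) ⬝ᵥ (fun i => (v i : R)) = (((adj ℤ G ^ k *ᵥ 1) ⬝ᵥ v : ℤ) : R) := by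
  have := cast_adj_mulVec (R := R) G k 1
  simp only [Pi.one_apply, Int.cast_one] at this
  change adj R G ^ k *ᵥ 1 = _ at this
  rw [this]
  simp [dotProduct]

theorem not_sq_dvd_snfDiag {n : ℕ} {l : Fin n → ℕ} {b : ℤ} (hb : Squarefree b) {p : ℕ}
    (hp : p.Prime) (hp2 : p ≠ 2) (i : Fin n) : ¬ (p : ℤ) ^ 2 ∣ snfDiag l b i := by
  have hpZ : Prime (p : ℤ) := Nat.prime_iff_prime_int.1 hp
  have hp2' : ∀ m : ℕ, ¬ (p : ℤ) ∣ 2 ^ m := fun m h => by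
    have h2 : p ∣ 2 := by exact_mod_cast hpZ.dvd_of_dvd_pow h
    exact hp2 ((Nat.prime_dvd_prime_iff_eq hp Nat.prime_two).1 h2)
  rw [snfDiag]
  split_ifs
  · exact fun h => hpZ.not_dvd_one ((dvd_pow_self _ two_ne_zero).trans h)
  · intro h
    have := hpZ.pow_dvd_of_dvd_mul_left 2 (hp2' _) h
    rw [sq] at this
    exact hpZ.not_isUnit (hb _ this)
  · exact fun h => hp2' _ ((dvd_pow_self _ two_ne_zero).trans h)

theorem snfDiag_cast_ne_zero {n : ℕ} {l : Fin n → ℕ} {b : ℤ} {p : ℕ}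
    (hp : p.Prime) (hp2 : p ≠ 2) {i : Fin n} (hi : (i : ℕ) + 1 ≠ n) :
    (snfDiag l b i : ZMod p) ≠ 0 := by
  have : Fact p.Prime := ⟨hp⟩
  have h2 : (2 : ZMod p) ≠ 0 := fun h => by
    have h' : p ∣ 2 := (ZMod.natCast_eq_zero_iff 2 p).1 (by exact_mod_cast h)
    exact hp2 ((Nat.prime_dvd_prime_iff_eq hp Nat.prime_two).1 h')
  rw [snfDiag, if_neg hi]
  split_ifs
  · simp
  · push_cast
    exact pow_ne_zero _ h2

theorem isUnit_of_det_eq {n : ℕ} {U : Matrix (Fin n) (Fin n) ℤ} (h : U.det = 1 ∨ U.det = -1) :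
    IsUnit Uᵀ := by
  rw [Matrix.isUnit_iff_isUnit_det, Matrix.det_transpose, Int.isUnit_iff]
  exact h

/-- A factorization `Wᵀ = V D T` with unimodular `V` and `T`. -/
theorem IsSmithNormalForm.transpose_eq {n : ℕ} {M : Matrix (Fin n) (Fin n) ℤ} {d : Fin n → ℤ}
    (h : IsSmithNormalForm M d) : ∃ V V' T T' : Matrix (Fin n) (Fin n) ℤ, V' * V = 1 ∧ T' * T = 1 ∧
      Mᵀ = V * (Matrix.diagonal d * T) := by
  obtain ⟨-, -, U, V, hU, hV, rfl⟩ := h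
  obtain ⟨T', hT'⟩ := (isUnit_of_det_eq hU).exists_left_inv
  obtain ⟨V', hV'⟩ := (isUnit_of_det_eq hV).exists_left_inv
  exact ⟨Vᵀ, V', Uᵀ, T', hV', hT', by simp [Matrix.transpose_mul]⟩

/-- In the unimodular coordinates `Tv` the system is diagonal. Since `p²` divides no diagonal entry,
`p` divides each coordinate of `Tv`, hence of `v`. -/
theorem dvd_of_sq_dvd_dotProduct {n : ℕ} {G : SimpleGraph (Fin n)} {l : Fin n → ℕ} {b : ℤ}
    (hb : Squarefree b) (hsnf : IsSmithNormalForm (walkMatrix G) (snfDiag l b)) {p : ℕ}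
    (hp : p.Prime) (hp2 : p ≠ 2) {v : Fin n → ℤ}
    (hv : ∀ k, (p : ℤ) ^ 2 ∣ (adj ℤ G ^ k *ᵥ 1) ⬝ᵥ v) (i : Fin n) : (p : ℤ) ∣ v i := by
  have hpZ : Prime (p : ℤ) := Nat.prime_iff_prime_int.1 hp
  obtain ⟨V, V', T, T', hV, hT, hW⟩ := hsnf.transpose_eq
  choose w hw using fun k : Fin n => hv k
  have hWv : (walkMatrix G)ᵀ *ᵥ v = ((p : ℤ) ^ 2) • w := by
    ext k
    rw [walkMatrix_transpose_mulVec, hw]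
    rfl
  have h1 : Matrix.diagonal (snfDiag l b) *ᵥ (T *ᵥ v) = ((p : ℤ) ^ 2) • (V' *ᵥ w) := by
    rw [← Matrix.mulVec_smul, ← hWv, hW]
    simp only [Matrix.mulVec_mulVec, ← Matrix.mul_assoc, hV, Matrix.one_mul]
  have h2 : ∀ j, (p : ℤ) ∣ (T *ᵥ v) j := by
    intro j
    by_contra hj
    have h3 := congrFun h1 j
    rw [Matrix.mulVec_diagonal] at h3
    exact not_sq_dvd_snfDiag hb hp hp2 j
      (hpZ.pow_dvd_of_dvd_mul_right 2 hj ⟨_, h3⟩)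
  have h4 : v = T' *ᵥ (T *ᵥ v) := by rw [Matrix.mulVec_mulVec, hT, Matrix.one_mulVec]
  rw [h4, Matrix.mulVec, dotProduct]
  exact Finset.dvd_sum fun j _ => (h2 j).mul_left (T' i j)

/-- The walk matrix has corank at most one modulo an odd prime. -/
theorem exists_smul_eq_of_dotProduct_eq_zero {n : ℕ} {G : SimpleGraph (Fin n)} {l : Fin n → ℕ}
    {b : ℤ} (hsnf : IsSmithNormalForm (walkMatrix G) (snfDiag l b)) {p : ℕ} [Fact p.Prime]
    (hp2 : p ≠ 2) {z y : Fin n → ZMod p} (hz0 : z ≠ 0)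
    (hz : ∀ k, (adj (ZMod p) G ^ k *ᵥ 1) ⬝ᵥ z = 0)
    (hy : ∀ k, (adj (ZMod p) G ^ k *ᵥ 1) ⬝ᵥ y = 0) : ∃ c : ZMod p, y = c • z := by
  have hp : p.Prime := Fact.out
  obtain ⟨V, V', T, T', hV, hT, hW⟩ := hsnf.transpose_eq
  let f := Int.castRingHom (ZMod p)
  have hWf : ((walkMatrix G)ᵀ).map f = V.map f * ((Matrix.diagonal (snfDiag l b)).map f * T.map f) := by
    rw [hW, Matrix.map_mul, Matrix.map_mul]
  have hone : (1 : Matrix (Fin n) (Fin n) ℤ).map f = 1 := Matrix.map_one _ (map_zero f) (map_one f)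
  have hVf : V'.map f * V.map f = 1 := by rw [← Matrix.map_mul, hV, hone]
  have hTf : T'.map f * T.map f = 1 := by rw [← Matrix.map_mul, hT, hone]
  have hzero : ∀ x : Fin n → ZMod p, (∀ k, (adj (ZMod p) G ^ k *ᵥ 1) ⬝ᵥ x = 0) →
      ∀ j : Fin n, (j : ℕ) + 1 ≠ n → (T.map f *ᵥ x) j = 0 := by
    intro x hx j hj
    have h1 : ((walkMatrix G)ᵀ).map f *ᵥ x = 0 := by
      ext k
      rw [Pi.zero_apply, ← hx k, ← map_adj, ← Matrix.map_pow]
      simp [Matrix.mulVec, dotProduct, walkMatrix, f]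
    have h2 : (Matrix.diagonal (snfDiag l b)).map f *ᵥ (T.map f *ᵥ x) = 0 := by
      have := congrArg (V'.map f *ᵥ ·) h1
      simpa only [hWf, Matrix.mulVec_mulVec, ← Matrix.mul_assoc, hVf, Matrix.one_mul,
        Matrix.mulVec_zero] using this
    have h3 := congrFun h2 j
    rw [Matrix.diagonal_map (map_zero f), Matrix.mulVec_diagonal] at h3
    exact (mul_eq_zero.1 h3).resolve_left (snfDiag_cast_ne_zero hp hp2 hj)
  have hinj : ∀ x : Fin n → ZMod p, T.map f *ᵥ x = 0 → x = 0 := by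
    intro x hx
    rw [← Matrix.one_mulVec x, ← hTf, ← Matrix.mulVec_mulVec, hx, Matrix.mulVec_zero]
  obtain ⟨j, hj⟩ : ∃ j, (T.map f *ᵥ z) j ≠ 0 := by
    by_contra! h
    exact hz0 (hinj z (funext h))
  -- Only the last diagonal entry, the one carrying `b`, can vanish mod `p`.
  have hjn : (j : ℕ) + 1 = n := by
    by_contra h
    exact hj (hzero z hz j h)
  refine ⟨(T.map f *ᵥ y) j / (T.map f *ᵥ z) j, sub_eq_zero.1 (hinj _ (funext fun i => ?_))⟩
  rw [Matrix.mulVec_sub, Matrix.mulVec_smul, Pi.sub_apply, Pi.smul_apply, smul_eq_mul]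
  by_cases hi : (i : ℕ) + 1 = n
  · obtain rfl : i = j := Fin.ext (by omega)
    rw [div_mul_cancel₀ _ hj, sub_self]
    rfl
  · rw [hzero y hy i hi, hzero z hz i hi, mul_zero, sub_self]
    rfl

/-- The bordered system `(A - c) y - s z = β`, `1 ⬝ y = α` is solvable for all `β` orthogonal to
the eigenvector `z`, provided that `z` spans the orthogonal complement of all `A ^ k 1`. -/
theorem exists_solution_bordered {n : ℕ} {F : Type} [Field F] (G : SimpleGraph (Fin n))
    {z : Fin n → F} (hz0 : z ≠ 0) (hz : ∀ k, (adj F G ^ k *ᵥ 1) ⬝ᵥ z = 0)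
    (hspan : ∀ y, (∀ k, (adj F G ^ k *ᵥ 1) ⬝ᵥ y = 0) → ∃ c : F, y = c • z)
    {c : F} (hc : adj F G *ᵥ z = c • z) (hzz : z ⬝ᵥ z = 0) {β : Fin n → F} (hβ : z ⬝ᵥ β = 0)
    (α : F) : ∃ y : Fin n → F, ∃ s : F, adj F G *ᵥ y - c • y - s • z = β ∧ 1 ⬝ᵥ y = α := by
  let N : ((Fin n → F) × F) →ₗ[F] ((Fin n → F) × F) :=
    { toFun := fun x => (adj F G *ᵥ x.1 - c • x.1 - x.2 • z, 1 ⬝ᵥ x.1)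
      map_add' := fun x y => by
        ext
        · simp [Matrix.mulVec_add]; ring
        · simp [dotProduct_add]
      map_smul' := fun a x => by
        ext
        · simp [Matrix.mulVec_smul]; ring
        · simp [dotProduct_smul] }
  let φ : ((Fin n → F) × F) →ₗ[F] F :=
    { toFun := fun x => z ⬝ᵥ x.1
      map_add' := fun x y => by simp [dotProduct_add]
      map_smul' := fun a x => by simp [dotProduct_smul] }
  have hs : (adj F G)ᵀ = adj F G := by
    classical exact G.isSymm_adjMatrix
  -- As `A` is symmetric and `z` is an isotropic eigenvector, the first component of every value of
  -- `N` is orthogonal to `z`.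
  have hle : LinearMap.range N ≤ LinearMap.ker φ := by
    rintro _ ⟨⟨y, s⟩, rfl⟩
    change z ⬝ᵥ (adj F G *ᵥ y - c • y - s • z) = 0
    rw [dotProduct_sub, dotProduct_sub, dotProduct_smul, dotProduct_smul, hzz,
      Matrix.dotProduct_mulVec, ← Matrix.mulVec_transpose, hs, hc, smul_dotProduct]
    simp
  have hkerN : LinearMap.ker N ≤ Submodule.span F {(z, 0)} := by
    rintro ⟨y, s⟩ hys
    have h1 : adj F G *ᵥ y - c • y - s • z = 0 := congrArg Prod.fst (LinearMap.mem_ker.1 hys)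
    have h2 : 1 ⬝ᵥ y = 0 := congrArg Prod.snd (LinearMap.mem_ker.1 hys)
    have h3 : adj F G *ᵥ y = c • y + s • z := by
      rw [← sub_eq_zero, ← h1]
      abel
    have hy : ∀ k, (adj F G ^ k *ᵥ 1) ⬝ᵥ y = 0 := by
      intro k
      induction k with
      | zero => simpa using h2
      | succ k ih =>
        rw [adj_pow_succ_dotProduct, h3, dotProduct_add, dotProduct_smul, dotProduct_smul, ih, hz]
        simp
    obtain ⟨a, rfl⟩ := hspan y hy
    have hs0 : s • z = 0 := by
      rw [Matrix.mulVec_smul, hc, smul_comm] at h3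
      exact left_eq_add.1 h3
    obtain rfl : s = 0 := (smul_eq_zero.1 hs0).resolve_right hz0
    exact Submodule.mem_span_singleton.2 ⟨a, by simp⟩
  -- In dimension `n + 1`, the range of `N` has dimension at least `n`, and `ker φ` at most `n`
  -- because `z ≠ 0`.
  have heq : LinearMap.range N = LinearMap.ker φ := by
    refine Submodule.eq_of_le_of_finrank_le hle ?_
    have h1 := N.finrank_range_add_finrank_ker
    have h2 := φ.finrank_range_add_finrank_ker
    have h3 : Module.finrank F (LinearMap.ker N) ≤ 1 :=
      (Submodule.finrank_mono hkerN).trans ((finrank_span_le_card _).trans (by simp))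
    have h4 : Module.finrank F (LinearMap.range φ) ≠ 0 := by
      rw [Ne, Submodule.finrank_eq_zero, LinearMap.range_eq_bot]
      intro hφ
      refine hz0 (funext fun i => ?_)
      have := LinearMap.congr_fun hφ (Pi.single i 1, 0)
      simpa [φ] using this
    omega
  have hmem : (β, α) ∈ LinearMap.range N := by
    rw [heq]
    exact hβ
  obtain ⟨⟨y, s⟩, hys⟩ := hmem
  exact ⟨y, s, congrArg Prod.fst hys, congrArg Prod.snd hys⟩

theorem cast_dotProduct {n : ℕ} {R : Type} [CommRing R] (u v : Fin n → ℤ) :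
    (fun i => (u i : R)) ⬝ᵥ (fun i => (v i : R)) = ((u ⬝ᵥ v : ℤ) : R) := by
  simp [dotProduct]

/-- If `u` were nonzero mod `p`, a Hensel-type step would correct it to `v = u + p y`, an
eigenvector mod `p²` whose entry sum vanishes mod `p²`. Then `eᵀAᵏv ≡ 0 (mod p²)` for all `k`,
contradicting the Smith form. -/
theorem dvd_of_odd_prime {n : ℕ} {G : SimpleGraph (Fin n)} {l : Fin n → ℕ} {b : ℤ}
    (hb : Squarefree b) (hsnf : IsSmithNormalForm (walkMatrix G) (snfDiag l b)) {p : ℕ}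
    (hp : p.Prime) (hp2 : p ≠ 2) {u : Fin n → ℤ}
    (h1 : ∀ k, (p : ℤ) ∣ (adj ℤ G ^ k *ᵥ 1) ⬝ᵥ u)
    (h2 : ∀ k, (p : ℤ) ^ 2 ∣ u ⬝ᵥ (adj ℤ G ^ k *ᵥ u)) (i : Fin n) : (p : ℤ) ∣ u i := by
  by_contra hi
  have : Fact p.Prime := ⟨hp⟩
  have hp0 : (p : ℤ) ≠ 0 := by exact_mod_cast hp.ne_zero
  have hcast : ∀ a : ℤ, (a : ZMod p) = 0 ↔ (p : ℤ) ∣ a :=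
    fun a => ZMod.intCast_zmod_eq_zero_iff_dvd a p
  set z : Fin n → ZMod p := fun i => (u i : ZMod p) with hz_def
  have hz0 : z ≠ 0 := fun h => hi ((hcast _).1 (congrFun h i))
  have hz : ∀ k, (adj (ZMod p) G ^ k *ᵥ 1) ⬝ᵥ z = 0 := fun k => by
    rw [hz_def, cast_adj_dotProduct, hcast]
    exact h1 k
  have hspan := fun y => exists_smul_eq_of_dotProduct_eq_zero (y := y) hsnf hp2 hz0 hz
  -- `Az` is again orthogonal to every `Aᵏe`, so it is a multiple of `z`.
  obtain ⟨c, hc⟩ := hspan (adj (ZMod p) G *ᵥ z) fun k => by rw [← adj_pow_succ_dotProduct, hz]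
  obtain ⟨μ, rfl⟩ := ZMod.intCast_surjective c
  have hAz : ∀ v : Fin n → ℤ, adj (ZMod p) G *ᵥ (fun i => (v i : ZMod p)) =
      fun i => ((adj ℤ G *ᵥ v) i : ZMod p) := fun v => by
    simpa using cast_adj_mulVec (R := ZMod p) G 1 v
  have hβ : ∀ i, (p : ℤ) ∣ (adj ℤ G *ᵥ u - μ • u) i := fun i => by
    rw [← hcast]
    have := congrFun hc i
    rw [hz_def, hAz] at this
    simp only [Pi.smul_apply, smul_eq_mul] at this
    simp only [Pi.sub_apply, Pi.smul_apply, smul_eq_mul]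
    push_cast
    rw [this, sub_self]
  choose β hβ using hβ
  have hβ' : adj ℤ G *ᵥ u = μ • u + (p : ℤ) • β := by
    ext i
    have := hβ i
    simp only [Pi.sub_apply] at this
    simp only [Pi.add_apply, Pi.smul_apply, smul_eq_mul] at this ⊢
    linarith
  -- The solvability condition for the correction: `uᵀAu = μ uᵀu + p uᵀβ`, where `p²` divides the
  -- first two terms.
  have huβ : (p : ℤ) ∣ u ⬝ᵥ β := by
    have h3 := h2 1
    have h4 := h2 0
    rw [pow_one, hβ', dotProduct_add, dotProduct_smul, dotProduct_smul, smul_eq_mul,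
      smul_eq_mul] at h3
    rw [pow_zero, Matrix.one_mulVec] at h4
    have h5 := (dvd_add_right (h4.mul_left μ)).1 h3
    rwa [sq, mul_dvd_mul_iff_left hp0] at h5
  obtain ⟨α, hα⟩ := h1 0
  -- The right-hand sides `-β` and `-α` cancel the errors of order `p` in the eigenvector equation
  -- and in `eᵀu = pα`; `s` adjusts the eigenvalue to `μ + ps`.
  obtain ⟨y', s', hy, hs⟩ := exists_solution_bordered G hz0 hz hspan hc
    (by
      rw [hz_def, cast_dotProduct, hcast]
      have := h2 0
      rw [pow_zero, Matrix.one_mulVec] at this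
      exact (dvd_pow_self _ two_ne_zero).trans this)
    (β := fun i => ((-β) i : ℤ)) (by
      rw [hz_def, cast_dotProduct, hcast, dotProduct_neg]
      exact huβ.neg_right) ((-α : ℤ) : ZMod p)
  obtain ⟨s, rfl⟩ := ZMod.intCast_surjective s'
  choose y hyy using fun j => ZMod.intCast_surjective (y' j)
  obtain rfl : (fun j => (y j : ZMod p)) = y' := funext hyy
  have hγ : ∀ i, (p : ℤ) ∣ (β + (adj ℤ G *ᵥ y - μ • y - s • u)) i := fun i => by
    rw [← hcast]
    have := congrFun hy i
    rw [hAz] at this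
    simp only [Pi.add_apply, Pi.sub_apply, Pi.smul_apply, Pi.neg_apply, smul_eq_mul, hz_def]
      at this ⊢
    push_cast at this ⊢
    rw [this, add_neg_cancel]
  choose γ hγ using hγ
  have hone : (p : ℤ) ∣ α + 1 ⬝ᵥ y := by
    rw [← hcast]
    have h3 := cast_adj_dotProduct (R := ZMod p) G 0 y
    rw [pow_zero, pow_zero, Matrix.one_mulVec, Matrix.one_mulVec, hs] at h3
    push_cast at h3 ⊢
    rw [← h3, add_neg_cancel]
  have hv : ∀ k, (p : ℤ) ^ 2 ∣ (adj ℤ G ^ k *ᵥ 1) ⬝ᵥ (u + (p : ℤ) • y) := by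
    have hAv : adj ℤ G *ᵥ (u + (p : ℤ) • y) = (μ + p * s) • (u + (p : ℤ) • y) +
        ((p : ℤ) ^ 2) • (γ - s • y) := by
      ext i
      have h3 := hγ i
      have h4 := congrFun hβ' i
      simp only [Matrix.mulVec_add, Matrix.mulVec_smul, Pi.add_apply, Pi.sub_apply,
        Pi.smul_apply, smul_eq_mul] at h3 h4 ⊢
      linear_combination h4 + (p : ℤ) * h3
    intro k
    induction k with
    | zero =>
      rw [dotProduct_add, hα, pow_zero, Matrix.one_mulVec, dotProduct_smul, smul_eq_mul, ← mul_add,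
        sq]
      exact mul_dvd_mul_left _ hone
    | succ k ih =>
      rw [adj_pow_succ_dotProduct, hAv, dotProduct_add, dotProduct_smul, dotProduct_smul,
        smul_eq_mul, smul_eq_mul]
      exact dvd_add (ih.mul_left _) (dvd_mul_right _ _)
  have h6 := dvd_of_sq_dvd_dotProduct hb hsnf hp hp2 hv i
  exact hi ((dvd_add_left (Dvd.intro _ rfl)).1 h6)

end GenSpec

/-! ### Conclusion: the level is one -/

theorem theorem4p2 (n : ℕ) (G : SimpleGraph (Fin n))
    (hG : GenSpec.Controllable G)
    (hrank : GenSpec.rank2 (GenSpec.walkMatrix G) = (n + 1) / 2)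
    (l : Fin n → ℕ) (b : ℤ) (hb : Squarefree b)
    (hsnf : GenSpec.IsSmithNormalForm (GenSpec.walkMatrix G) (GenSpec.snfDiag l b))
    (hker : GenSpec.KernelCondition G) :
    GenSpec.IsDGS G := by
  intro m H hGH
  -- The number of eigenvalues is the number of vertices.
  obtain rfl : n = m := by rw [← GenSpec.card_spec G, hGH.1, GenSpec.card_spec]
  obtain ⟨M, a, -, hM, hprim⟩ := GenSpec.exists_primitive_isScaledConjugator hGH.walkCount_eq hG
  have hunit : IsUnit a := by
    rw [Int.isUnit_iff_natAbs_eq]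
    by_contra hne
    obtain ⟨p, hp, hpa⟩ := Nat.exists_prime_and_dvd hne
    have hpa' : (p : ℤ) ∣ a := Int.natCast_dvd.2 hpa
    obtain ⟨i, j, hij⟩ := hprim p hp hpa'
    have h1 := fun k => hpa'.trans (hM.col j k).1
    have h2 := fun k => (pow_dvd_pow_of_dvd hpa' 2).trans (hM.col j k).2
    by_cases hp2 : p = 2
    · subst hp2
      exact hij (GenSpec.two_dvd_of_kernelCondition hrank hker h1 (by simpa using h2) i)
    · exact hij (GenSpec.dvd_of_odd_prime hb hsnf hp hp2 h1 h2 i)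
  rcases Int.isUnit_iff.1 hunit with rfl | rfl
  · exact hM.nonempty_iso
  · exact hM.neg.nonempty_iso
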